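/- Let $K$ be a field of characteristic $0$, let $q$ be an indeterminate, and let $\mathcal H_n(q)$ be the Hecke algebra of the symmetric group $\mathfrak S_n$ over $K(q)$, i.e. the $K(q)$-algebra with generators $T_1,\dots,T_{n-1}$ and relations $(T_i+1)(T_i-q)=0$, $T_iT_j=T_jT_i$ for $|i-j|\ge 2$, and $T_iT_{i+1}T_i=T_{i+1}T_iT_{i+1}$. For $w\in\mathfrak S_n$ put $T_w=T_{a_1}\cdots T_{a_r}$, where $w=s_{a_1}\cdots s_{a_r}$ is a reduced decomposition of $w$ into adjacent transpositions $s_i=(i,i+1)$, and let $E_i=\frac{1}{q+1}(q-1-2T_i)$. Then there are unique coefficients $c_w(q)\in K(q)$ with $$E_1E_2\cdots E_{n-1}\,E_1E_2\cdots E_{n-2}\cdots E_1E_2\,E_1=\sum_{w\in\mathfrak S_n}c_w(q)\,T_w .$$ For $w=a_1a_2\cdots a_n\in\mathfrak S_n$ let $\widehat w=a_n\cdots a_2a_1$ be its reversal, and let $\kappa(\widehat w)$ be the number of cycles of $\widehat w$ (fixed points included). Then for every $w\in\mathfrak S_n$ the coefficient $c_w(q)$ is divisible by $(q-1)^{n-\kappa(\widehat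 w)}$ in $K[q,(q+1)^{-1}]$; that is, $c_w(q)=(q-1)^{n-\kappa(\widehat w)}\,g(q)/(q+1)^N$ for some polynomial $g\in K[q]$ and some integer $N\ge 0$. -/

import Mathlib

open Equiv

/-- Defining relations of the Hecke algebra of the symmetric group on `n` letters with parameter
`q`, on generators `T_i`. The index `i : Fin (n - 1)` stands for the generator usually numbered
`i + 1`. -/
inductive HeckeRel (R : Type*) [CommRing R] (q : R) (n : ℕ) :
    FreeAlgebra R (Fin (n - 1)) → FreeAlgebra R (Fin (n - 1)) → Prop
  | quadratic (i : Fin (n - 1)) :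
      HeckeRel R q n
        ((FreeAlgebra.ι R i + 1) * (FreeAlgebra.ι R i - algebraMap R _ q)) 0
  | comm (i j : Fin (n - 1)) (h : (i : ℕ) + 2 ≤ j ∨ (j : ℕ) + 2 ≤ i) :
      HeckeRel R q n
        (FreeAlgebra.ι R i * FreeAlgebra.ι R j) (FreeAlgebra.ι R j * FreeAlgebra.ι R i)
  | braid (i j : Fin (n - 1)) (h : (j : ℕ) = i + 1) :
      HeckeRel R q n
        (FreeAlgebra.ι R i * FreeAlgebra.ι R j * FreeAlgebra.ι R i)
        (FreeAlgebra.ι R j * FreeAlgebra.ι R i * FreeAlgebra.ι R j)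

/-- The Hecke algebra `H_n(q)` over `R`, by generators and relations. -/
abbrev HeckeAlgebra (R : Type*) [CommRing R] (q : R) (n : ℕ) : Type _ :=
  RingQuot (HeckeRel R q n)

/-- The generator `T_i` of `H_n(q)`. -/
noncomputable def heckeGen {R : Type*} [CommRing R] (q : R) (n : ℕ) (i : Fin (n - 1)) :
    HeckeAlgebra R q n :=
  RingQuot.mkAlgHom R (HeckeRel R q n) (FreeAlgebra.ι R i)

/-- The adjacent transposition `s_i`, exchanging the consecutive letters `i` and `i + 1`
of `Fin n`. -/
def adjSwap (n : ℕ) (i : Fin (n - 1)) : Perm (Fin n) :=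
  swap ⟨i, by omega⟩ ⟨i + 1, by omega⟩

/-- `a` is a reduced decomposition of `w`: `w = s_{a_1} ⋯ s_{a_r}` with `r` as small as
possible. -/
def IsReducedDecomposition {n : ℕ} (w : Perm (Fin n)) (a : List (Fin (n - 1))) : Prop :=
  (a.map (adjSwap n)).prod = w ∧
    ∀ b : List (Fin (n - 1)), (b.map (adjSwap n)).prod = w → a.length ≤ b.length

theorem exists_adjSwap_word {n : ℕ} (w : Perm (Fin n)) :
    ∃ a : List (Fin (n - 1)), (a.map (adjSwap n)).prod = w := by
  cases n with
  | zero => exact ⟨[], Subsingleton.elim _ _⟩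
  | succ m =>
    have h : w ∈ Submonoid.closure
        (Set.range fun i : Fin m => swap i.castSucc i.succ) := by
      rw [Equiv.Perm.mclosure_swap_castSucc_succ]; trivial
    induction h using Submonoid.closure_induction with
    | mem x hx => obtain ⟨i, rfl⟩ := hx; exact ⟨[i], by simp [adjSwap]; rfl⟩
    | one => exact ⟨[], rfl⟩
    | mul x y _ _ hx hy =>
      obtain ⟨a, rfl⟩ := hx
      obtain ⟨b, rfl⟩ := hy
      exact ⟨a ++ b, by simp⟩

theorem exists_isReducedDecomposition {n : ℕ} (w : Perm (Fin n)) :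
    ∃ a : List (Fin (n - 1)), IsReducedDecomposition w a := by
  classical
  have h : ∃ r, ∃ a : List (Fin (n - 1)), a.length = r ∧ (a.map (adjSwap n)).prod = w := by
    obtain ⟨a, ha⟩ := exists_adjSwap_word w
    exact ⟨_, a, rfl, ha⟩
  obtain ⟨a, hl, ha⟩ := Nat.find_spec h
  exact ⟨a, ha, fun b hb => hl ▸ Nat.find_min' h ⟨b, rfl, hb⟩⟩

/-- The standard basis element `T_w = T_{a_1} ⋯ T_{a_r}`, for a reduced decomposition
`(a_1, …, a_r)` of `w`; by a standard fact the choice of the decomposition does not matter. -/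
noncomputable def heckeT {R : Type*} [CommRing R] (q : R) {n : ℕ} (w : Perm (Fin n)) :
    HeckeAlgebra R q n :=
  ((exists_isReducedDecomposition w).choose.map (heckeGen q n)).prod

/-- `E_i = (q - 1 - 2 T_i) / (q + 1)`. -/
noncomputable def heckeE {F : Type*} [Field F] (q : F) (n : ℕ) (i : Fin (n - 1)) :
    HeckeAlgebra F q n :=
  (q + 1)⁻¹ • (algebraMap F (HeckeAlgebra F q n) (q - 1) - 2 * heckeGen q n i)

/-- The sequence `1, 2, …, n-1, 1, 2, …, n-2, …, 1, 2, 1` (with letters shifted down by one). -/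
def evacWord (n : ℕ) : List (Fin (n - 1)) :=
  (List.finRange (n - 1)).flatMap fun j => (List.finRange (n - 1)).take (n - 1 - j)

/-- The product `E_1 E_2 ⋯ E_{n-1} E_1 E_2 ⋯ E_{n-2} ⋯ E_1 E_2 E_1`. -/
noncomputable def evacProduct {F : Type*} [Field F] (q : F) (n : ℕ) : HeckeAlgebra F q n :=
  ((evacWord n).map (heckeE q n)).prod

/-- `c` is a family of coefficients of the product above in terms of the elements `T_w`. -/
def IsEvacExpansion {F : Type*} [Field F] (q : F) (n : ℕ) (c : Perm (Fin n) → F) : Prop :=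
  evacProduct q n = ∑ w : Perm (Fin n), c w • heckeT q w

/-- The reversal of `w = a_1 a_2 ⋯ a_n` is `a_n ⋯ a_2 a_1`, i.e. `i ↦ w (n + 1 - i)`. It is the
product of `w` and the longest permutation `w_0` in which `w_0` acts first. -/
def reversal {n : ℕ} (w : Perm (Fin n)) : Perm (Fin n) :=
  Fin.revPerm.trans w

/-- The number of cycles of a permutation, fixed points counted as cycles. -/
def numCycles {n : ℕ} (w : Perm (Fin n)) : ℕ :=
  w.cycleType.card + (Finset.univ.filter fun i => w i = i).card

/-! The divisibility holds for every word, reduced or not: if v = s_{a_1}⋯s_{a_r}, the coefficient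
of T_w in E_{a_1}⋯E_{a_r} is divisible by (q-1)^{n-κ(w⁻¹v)}. Multiplying on the left by E_i turns v
into s_i v, and the new coefficient at w has two kinds of contribution. The one from the old
coefficient at s_i w already has the right exponent, since (s_i w)⁻¹v = w⁻¹s_i v. The other is a
multiple of q-1 times the old coefficient at w; as w⁻¹s_i v and w⁻¹v differ by a transposition, n-κ
grows by at most one and the factor q-1 pays for it. This is `exists_expansion_prod_heckeE`, resting
on `numCycles_le_numCycles_swap_mul_add_one`. The given word has v = w₀ (`prod_evacWord`), and w⁻¹w₀
is conjugate to the inverse of ww₀, the reversal of w.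

Uniqueness is linear independence of the T_w. Matsumoto's theorem (`SatisfiesBraid.prod_eq`) frees
T_w from the chosen reduced word and so yields the rule for T_i T_w. The operators dictated by that
rule satisfy the Hecke relations, and in the resulting representation T_w carries the indicator of 1
to that of w. -/

/-! ### Inversions, left descents and Coxeter length. -/

section Inversions

variable {n : ℕ}

/-- The smaller of the two letters exchanged by `adjSwap n i`. -/
def adjLo (i : Fin (n - 1)) : Fin n := ⟨i, by omega⟩

/-- The larger of the two letters exchanged by `adjSwap n i`. -/
def adjHi (i : Fin (n - 1)) : Fin n := ⟨i + 1, by omega⟩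

theorem adjSwap_eq (i : Fin (n - 1)) : adjSwap n i = swap (adjLo i) (adjHi i) := rfl

@[simp] theorem adjSwap_adjLo (i : Fin (n - 1)) : adjSwap n i (adjLo i) = adjHi i :=
  swap_apply_left _ _

@[simp] theorem adjSwap_adjHi (i : Fin (n - 1)) : adjSwap n i (adjHi i) = adjLo i :=
  swap_apply_right _ _

@[simp] theorem adjSwap_inv (i : Fin (n - 1)) : (adjSwap n i)⁻¹ = adjSwap n i :=
  swap_inv _ _

@[simp] theorem adjSwap_mul_self (i : Fin (n - 1)) : adjSwap n i * adjSwap n i = 1 :=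
  swap_mul_self _ _

@[simp] theorem adjSwap_mul_cancel (i : Fin (n - 1)) (w : Perm (Fin n)) :
    adjSwap n i * (adjSwap n i * w) = w := by rw [← mul_assoc]; simp

theorem adjSwap_val (i : Fin (n - 1)) (x : Fin n) :
    (adjSwap n i x : ℕ) =
      if (x : ℕ) = i then (i : ℕ) + 1 else if (x : ℕ) = i + 1 then (i : ℕ) else x := by
  rw [adjSwap_eq, swap_apply_def]
  simp only [adjLo, adjHi, Fin.ext_iff]
  split_ifs <;> rfl

theorem adjSwap_comm (i j : Fin (n - 1)) (h : (i : ℕ) + 2 ≤ j ∨ (j : ℕ) + 2 ≤ i) :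
    adjSwap n i * adjSwap n j = adjSwap n j * adjSwap n i := by
  ext x
  simp only [Perm.mul_apply, adjSwap_val]
  split_ifs <;> omega

theorem adjSwap_braid (i j : Fin (n - 1)) (h : (j : ℕ) = i + 1) :
    adjSwap n i * adjSwap n j * adjSwap n i = adjSwap n j * adjSwap n i * adjSwap n j := by
  have hlo : adjLo j = adjHi i := Fin.ext h
  have h1 : adjLo i ≠ adjHi i := fun e => by simp [adjLo, adjHi] at e
  have h2 : adjHi i ≠ adjHi j := fun e => by simp [adjHi] at e; omega
  have h3 : adjLo i ≠ adjHi j := fun e => by simp [adjLo, adjHi] at e; omega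
  rw [adjSwap_eq, adjSwap_eq, hlo, swap_mul_swap_mul_swap h1 h3, swap_comm (adjLo i),
    swap_comm (adjHi i) (adjHi j), swap_mul_swap_mul_swap h2.symm h3.symm, swap_comm]

/-- The letter `i + 1` occurs before the letter `i` in `w`. -/
def IsLeftDescent (w : Perm (Fin n)) (i : Fin (n - 1)) : Prop :=
  w⁻¹ (adjHi i) < w⁻¹ (adjLo i)

instance (w : Perm (Fin n)) (i : Fin (n - 1)) : Decidable (IsLeftDescent w i) :=
  inferInstanceAs (Decidable (_ < _))

theorem inv_adjSwap_mul_apply (i : Fin (n - 1)) (w : Perm (Fin n)) (x : Fin n) :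
    (adjSwap n i * w)⁻¹ x = w⁻¹ (adjSwap n i x) := by
  rw [mul_inv_rev, adjSwap_inv, Perm.mul_apply]

theorem adjLo_lt_adjHi (i : Fin (n - 1)) : adjLo i < adjHi i := by
  simp [adjLo, adjHi, Fin.lt_def]

theorem isLeftDescent_adjSwap_mul (w : Perm (Fin n)) (i : Fin (n - 1)) :
    IsLeftDescent (adjSwap n i * w) i ↔ ¬ IsLeftDescent w i := by
  unfold IsLeftDescent
  rw [inv_adjSwap_mul_apply, inv_adjSwap_mul_apply, adjSwap_adjLo, adjSwap_adjHi, not_lt]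
  refine ⟨le_of_lt, fun h => lt_of_le_of_ne h fun e => ?_⟩
  exact (adjLo_lt_adjHi i).ne (w⁻¹.injective e)

/-- The set of pairs of letters which occur in `w` in the wrong order. -/
def inversionSet (w : Perm (Fin n)) : Finset (Fin n × Fin n) :=
  Finset.univ.filter fun p => p.1 < p.2 ∧ w⁻¹ p.2 < w⁻¹ p.1

/-- The number of inversions. -/
def inversionNumber (w : Perm (Fin n)) : ℕ := (inversionSet w).card

/-- Inversions are recorded as pairs of letters. Renaming letters by s_i keeps the order within
every pair except the pair (i, i+1) itself, which becomes the one new inversion. -/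
theorem inversionNumber_adjSwap_mul (w : Perm (Fin n)) (i : Fin (n - 1))
    (h : ¬ IsLeftDescent w i) :
    inversionNumber (adjSwap n i * w) = inversionNumber w + 1 := by
  have key : inversionSet (adjSwap n i * w) =
      insert (adjLo i, adjHi i)
        ((inversionSet w).map ((adjSwap n i).prodCongr (adjSwap n i)).toEmbedding) := by
    ext ⟨x, y⟩
    have hsymm : (adjSwap n i).symm = adjSwap n i := adjSwap_inv i
    simp only [inversionSet, Finset.mem_filter, Finset.mem_univ, true_and, Finset.mem_insert,
      Finset.mem_map_equiv, inv_adjSwap_mul_apply, Equiv.prodCongr_symm, Equiv.prodCongr_apply,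
      Prod.map, hsymm, Prod.mk.injEq]
    by_cases hxy : x = adjLo i ∧ y = adjHi i
    · obtain ⟨rfl, rfl⟩ := hxy
      simp only [adjLo_lt_adjHi, adjSwap_adjHi, adjSwap_adjLo, true_and, and_self, true_or,
        iff_true]
      exact (not_lt.1 h).lt_of_ne fun e => (adjLo_lt_adjHi i).ne (w⁻¹.injective e)
    · simp only [hxy, false_or]
      by_cases hyx : x = adjHi i ∧ y = adjLo i
      · obtain ⟨rfl, rfl⟩ := hyx
        simp only [adjSwap_adjHi, adjSwap_adjLo]
        exact iff_of_false (fun H => (adjLo_lt_adjHi i).asymm H.1) (fun H => h H.2)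
      · refine and_congr_left fun _ => ?_
        simp only [adjLo, adjHi, Fin.ext_iff] at hxy hyx
        simp only [Fin.lt_def, adjSwap_val]
        split_ifs <;> omega
  unfold inversionNumber
  rw [key, Finset.card_insert_of_notMem, Finset.card_map]
  rw [Finset.mem_map_equiv]
  have hsymm : (adjSwap n i).symm = adjSwap n i := adjSwap_inv i
  simp only [inversionSet, Finset.mem_filter, Finset.mem_univ, true_and,
    Equiv.prodCongr_symm, Equiv.prodCongr_apply, Prod.map, hsymm, adjSwap_adjHi, adjSwap_adjLo]
  exact fun H => (adjLo_lt_adjHi i).asymm H.1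

theorem inversionNumber_adjSwap_mul_add_one (w : Perm (Fin n)) (i : Fin (n - 1))
    (h : IsLeftDescent w i) :
    inversionNumber (adjSwap n i * w) + 1 = inversionNumber w := by
  rw [← inversionNumber_adjSwap_mul _ i, adjSwap_mul_cancel]
  rw [isLeftDescent_adjSwap_mul]
  exact not_not.2 h

theorem inversionNumber_adjSwap_mul_le (w : Perm (Fin n)) (i : Fin (n - 1)) :
    inversionNumber (adjSwap n i * w) ≤ inversionNumber w + 1 := by
  by_cases h : IsLeftDescent w i
  · have := inversionNumber_adjSwap_mul_add_one w i h; omega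
  · exact (inversionNumber_adjSwap_mul w i h).le

theorem inversionNumber_one : inversionNumber (1 : Perm (Fin n)) = 0 := by
  rw [inversionNumber, Finset.card_eq_zero, inversionSet, Finset.filter_eq_empty_iff]
  rintro ⟨x, y⟩ _ ⟨h1, h2⟩
  exact h1.asymm h2

theorem inversionNumber_prod_le (a : List (Fin (n - 1))) :
    inversionNumber (a.map (adjSwap n)).prod ≤ a.length := by
  induction a with
  | nil => simp [inversionNumber_one]
  | cons i a ih =>
    rw [List.map_cons, List.prod_cons, List.length_cons]
    exact (inversionNumber_adjSwap_mul_le _ _).trans (by omega)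

/-- Without descents w⁻¹ increases at each step, and the only increasing permutation is the
identity. -/
theorem eq_one_of_no_leftDescent (w : Perm (Fin n)) (h : ∀ i, ¬ IsLeftDescent w i) : w = 1 := by
  cases n with
  | zero => exact Subsingleton.elim _ _
  | succ m =>
    have hm : StrictMono (w⁻¹ : Perm (Fin (m + 1))) := by
      rw [Fin.strictMono_iff_lt_succ]
      intro i
      exact (not_lt.1 (h i)).lt_of_ne fun e =>
        (adjLo_lt_adjHi (n := m + 1) i).ne (w⁻¹.injective e)
    have h2 : (w⁻¹ : Perm (Fin (m + 1))) = 1 := by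
      have := (hm.range_inj strictMono_id).1 (by
        rw [Set.range_id]; exact w⁻¹.surjective.range_eq)
      ext x; rw [this]; rfl
    exact inv_eq_one.1 h2

/-- Stripping left descents removes one inversion at a time until 1 is reached. With
`inversionNumber_prod_le` this identifies the inversion number with the length of reduced words. -/
theorem exists_word_length_eq_inversionNumber (w : Perm (Fin n)) :
    ∃ a : List (Fin (n - 1)), (a.map (adjSwap n)).prod = w ∧ a.length = inversionNumber w := by
  induction hk : inversionNumber w generalizing w with
  | zero =>
    refine ⟨[], ?_, rfl⟩
    refine (eq_one_of_no_leftDescent w fun i hi => ?_).symm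
    have := inversionNumber_adjSwap_mul_add_one w i hi
    omega
  | succ k ih =>
    have : ∃ i, IsLeftDescent w i := by
      by_contra! hne
      rw [eq_one_of_no_leftDescent w hne, inversionNumber_one] at hk
      omega
    obtain ⟨i, hi⟩ := this
    have h1 := inversionNumber_adjSwap_mul_add_one w i hi
    obtain ⟨a, ha, hl⟩ := ih (adjSwap n i * w) (by omega)
    exact ⟨i :: a, by simp [ha], by simp [hl]⟩

theorem IsReducedDecomposition.length_eq {w : Perm (Fin n)} {a : List (Fin (n - 1))}
    (h : IsReducedDecomposition w a) : a.length = inversionNumber w := by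
  obtain ⟨b, hb, hl⟩ := exists_word_length_eq_inversionNumber w
  refine le_antisymm (hl ▸ h.2 b hb) ?_
  rw [← h.1]
  exact inversionNumber_prod_le a

end Inversions

/-! ### Matsumoto's theorem. -/

section Matsumoto

variable {n : ℕ} {M : Type*} [Monoid M]

/-- The family `f` satisfies the braid relations of the symmetric group on `n` letters. -/
structure SatisfiesBraid (f : Fin (n - 1) → M) : Prop where
  comm : ∀ i j : Fin (n - 1), (i : ℕ) + 2 ≤ j → f i * f j = f j * f i
  braid : ∀ i j : Fin (n - 1), (j : ℕ) = i + 1 → f i * f j * f i = f j * f i * f j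

theorem isLeftDescent_adjSwap_mul_of_far {w : Perm (Fin n)} {i j : Fin (n - 1)}
    (h : (i : ℕ) + 2 ≤ j ∨ (j : ℕ) + 2 ≤ i) :
    IsLeftDescent (adjSwap n i * w) j ↔ IsLeftDescent w j := by
  unfold IsLeftDescent
  rw [inv_adjSwap_mul_apply, inv_adjSwap_mul_apply]
  have h1 : adjSwap n i (adjHi j) = adjHi j := by
    apply swap_apply_of_ne_of_ne <;> intro e <;> simp [adjHi] at e <;> omega
  have h2 : adjSwap n i (adjLo j) = adjLo j := by
    apply swap_apply_of_ne_of_ne <;> intro e <;> simp [adjLo] at e <;> omega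
  rw [h1, h2]

theorem adjLo_eq_adjHi {i j : Fin (n - 1)} (h : (j : ℕ) = i + 1) : adjLo j = adjHi i :=
  Fin.ext h

theorem adjSwap_adjHi_succ {i j : Fin (n - 1)} (h : (j : ℕ) = i + 1) :
    adjSwap n i (adjHi j) = adjHi j := by
  apply swap_apply_of_ne_of_ne <;> intro e <;> simp [adjHi] at e <;> omega

theorem adjSwap_succ_adjLo {i j : Fin (n - 1)} (h : (j : ℕ) = i + 1) :
    adjSwap n j (adjLo i) = adjLo i := by
  apply swap_apply_of_ne_of_ne <;> intro e <;> simp [adjLo] at e <;> omega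

/-- If two adjacent letters are both left descents, then a reduced word of `w` starts with the
longest element of the corresponding parabolic subgroup. -/
theorem inversionNumber_of_adjacent_descents {w : Perm (Fin n)} {i j : Fin (n - 1)}
    (h : (j : ℕ) = i + 1) (hi : IsLeftDescent w i) (hj : IsLeftDescent w j) :
    inversionNumber (adjSwap n i * (adjSwap n j * (adjSwap n i * w))) + 3 = inversionNumber w := by
  have e1 := inversionNumber_adjSwap_mul_add_one w i hi
  have d2 : IsLeftDescent (adjSwap n i * w) j := by
    unfold IsLeftDescent at *
    rw [inv_adjSwap_mul_apply, inv_adjSwap_mul_apply, adjSwap_adjHi_succ h, adjLo_eq_adjHi h,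
      adjSwap_adjHi]
    rw [adjLo_eq_adjHi h] at hj
    exact hj.trans hi
  have e2 := inversionNumber_adjSwap_mul_add_one _ j d2
  have d3 : IsLeftDescent (adjSwap n j * (adjSwap n i * w)) i := by
    unfold IsLeftDescent at *
    rw [inv_adjSwap_mul_apply, inv_adjSwap_mul_apply, inv_adjSwap_mul_apply, inv_adjSwap_mul_apply,
      adjSwap_succ_adjLo h, ← adjLo_eq_adjHi h, adjSwap_adjLo, adjSwap_adjLo, adjSwap_adjHi_succ h,
      ← adjLo_eq_adjHi h]
    exact hj
  have e3 := inversionNumber_adjSwap_mul_add_one _ i d3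
  omega

theorem adjSwap_braid_mul {i j : Fin (n - 1)} (h : (j : ℕ) = i + 1) (w : Perm (Fin n)) :
    adjSwap n i * (adjSwap n j * (adjSwap n i * w)) =
      adjSwap n j * (adjSwap n i * (adjSwap n j * w)) := by
  simpa only [mul_assoc] using congrArg (· * w) (adjSwap_braid i j h)

/-- Any two words for `w` of length the number of inversions of `w` have the same value in a monoid
in which the braid relations hold. -/
theorem SatisfiesBraid.prod_eq {f : Fin (n - 1) → M} (hf : SatisfiesBraid f) (k : ℕ) :
    ∀ a b : List (Fin (n - 1)), a.length = k →
      (a.map (adjSwap n)).prod = (b.map (adjSwap n)).prod →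
      a.length = inversionNumber (a.map (adjSwap n)).prod →
      b.length = inversionNumber (b.map (adjSwap n)).prod →
      (a.map f).prod = (b.map f).prod := by
  induction k with
  | zero =>
    intro a b hk hab ha hb
    rw [← hab, ← ha, hk] at hb
    rw [List.length_eq_zero_iff.1 hk, List.length_eq_zero_iff.1 hb]
  | succ k ih =>
    -- The claim is symmetric in the two words, so their first letters may be taken with i ≤ j.
    have key : ∀ (i j : Fin (n - 1)) (a b : List (Fin (n - 1))), i ≤ j → a.length = k →
        adjSwap n i * (a.map (adjSwap n)).prod = adjSwap n j * (b.map (adjSwap n)).prod →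
        a.length + 1 = inversionNumber (adjSwap n i * (a.map (adjSwap n)).prod) →
        b.length + 1 = inversionNumber (adjSwap n j * (b.map (adjSwap n)).prod) →
        f i * (a.map f).prod = f j * (b.map f).prod := by
      intro i j a b hij hk hab ha hb
      have hbk : b.length = k := by rw [← hab] at hb; omega
      obtain ⟨w, hw⟩ : ∃ w, w = adjSwap n i * (a.map (adjSwap n)).prod := ⟨_, rfl⟩
      have hwj : w = adjSwap n j * (b.map (adjSwap n)).prod := hw.trans hab
      have ha' : (a.map (adjSwap n)).prod = adjSwap n i * w := by rw [hw, adjSwap_mul_cancel]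
      have hb' : (b.map (adjSwap n)).prod = adjSwap n j * w := by rw [hwj, adjSwap_mul_cancel]
      rw [← hw] at ha
      rw [← hwj] at hb
      have la := inversionNumber_prod_le a
      have lb := inversionNumber_prod_le b
      rw [ha'] at la
      rw [hb'] at lb
      have di : IsLeftDescent w i := by
        by_contra hc
        have := inversionNumber_adjSwap_mul w i hc
        omega
      have dj : IsLeftDescent w j := by
        by_contra hc
        have := inversionNumber_adjSwap_mul w j hc
        omega
      have ei := inversionNumber_adjSwap_mul_add_one w i di
      have ej := inversionNumber_adjSwap_mul_add_one w j dj
      rcases (by have := Fin.le_def.1 hij; omega :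
        (i : ℕ) = j ∨ (j : ℕ) = i + 1 ∨ (i : ℕ) + 2 ≤ j) with h | h | h
      · obtain rfl : i = j := Fin.ext h
        rw [ih a b hk (by rw [ha', hb']) (by rw [ha']; omega) (by rw [hb']; omega)]
      -- Adjacent letters: w has reduced words i j i c and j i j c. By induction each given word may
      -- be replaced by the one with the same first letter, and the braid relation joins the two.
      · have e3 := inversionNumber_of_adjacent_descents h di dj
        obtain ⟨c, hc, hl⟩ := exists_word_length_eq_inversionNumber
          (adjSwap n i * (adjSwap n j * (adjSwap n i * w)))
        have p1 : ((j :: i :: c).map (adjSwap n)).prod = adjSwap n i * w := by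
          simp [hc]
        have p2 : ((i :: j :: c).map (adjSwap n)).prod = adjSwap n j * w := by
          simp [hc, adjSwap_braid_mul h]
        have q1 := ih a (j :: i :: c) hk (by rw [p1, ha']) (by rw [ha']; omega)
          (by rw [p1]; simp; omega)
        have q2 := ih b (i :: j :: c) hbk (by rw [p2, hb']) (by rw [hb']; omega)
          (by rw [p2]; simp; omega)
        rw [q1, q2]
        simpa [mul_assoc] using congrArg (· * (c.map f).prod) (hf.braid i j h)
      -- Distant letters: the same argument with the reduced words i j c and j i c.
      · have e2 := inversionNumber_adjSwap_mul_add_one (adjSwap n i * w) j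
          ((isLeftDescent_adjSwap_mul_of_far (Or.inl h)).2 dj)
        obtain ⟨c, hc, hl⟩ := exists_word_length_eq_inversionNumber
          (adjSwap n j * (adjSwap n i * w))
        have p1 : ((j :: c).map (adjSwap n)).prod = adjSwap n i * w := by
          simp [hc]
        have p2 : ((i :: c).map (adjSwap n)).prod = adjSwap n j * w := by
          rw [List.map_cons, List.prod_cons, hc, ← mul_assoc, ← mul_assoc,
            adjSwap_comm i j (Or.inl h), mul_assoc, mul_assoc, adjSwap_mul_cancel]
        have q1 := ih a (j :: c) hk (by rw [p1, ha']) (by rw [ha']; omega)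
          (by rw [p1]; simp; omega)
        have q2 := ih b (i :: c) hbk (by rw [p2, hb']) (by rw [hb']; omega)
          (by rw [p2]; simp; omega)
        rw [q1, q2]
        simpa [mul_assoc] using congrArg (· * (c.map f).prod) (hf.comm i j h)
    intro a b hk hab ha hb
    have hbk : b.length = k + 1 := by rw [hb, ← hab, ← ha, hk]
    obtain ⟨i, a, rfl⟩ := List.exists_cons_of_length_eq_add_one hk
    obtain ⟨j, b, rfl⟩ := List.exists_cons_of_length_eq_add_one hbk
    simp only [List.map_cons, List.prod_cons, List.length_cons, Nat.add_right_cancel_iff]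
      at hk hbk hab ha hb ⊢
    rcases le_total i j with h | h
    · exact key i j a b h hk hab ha hb
    · exact (key j i b a h hbk hab.symm hb ha).symm

end Matsumoto

/-! ### The regular representation and independence of the T_w. -/

section HeckeAlgebra

variable {R : Type*} [CommRing R] (q : R) {n : ℕ}

theorem mul_self_of_quadratic {A : Type*} [Ring A] [Algebra R A] {t : A}
    (h : (t + 1) * (t - algebraMap R A q) = 0) : t * t = (q - 1) • t + q • 1 := by
  rw [Algebra.algebraMap_eq_smul_one] at h
  rw [← sub_eq_zero, ← h]
  simp only [add_mul, mul_sub, mul_smul_comm, mul_one, one_mul, sub_smul, one_smul, smul_add]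
  abel

theorem heckeGen_mul_self (i : Fin (n - 1)) :
    heckeGen q n i * heckeGen q n i = (q - 1) • heckeGen q n i + q • 1 := by
  have h := RingQuot.mkAlgHom_rel R (HeckeRel.quadratic (R := R) (q := q) (n := n) i)
  simp only [map_mul, map_add, map_sub, map_one, map_zero, AlgHom.commutes] at h
  exact mul_self_of_quadratic q h

theorem satisfiesBraid_heckeGen : SatisfiesBraid (heckeGen q n) where
  comm i j h := by
    have := RingQuot.mkAlgHom_rel R (HeckeRel.comm (R := R) (q := q) (n := n) i j (Or.inl h))
    simp only [map_mul] at this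
    exact this
  braid i j h := by
    have := RingQuot.mkAlgHom_rel R (HeckeRel.braid (R := R) (q := q) (n := n) i j h)
    simp only [map_mul] at this
    exact this

/-- The standard basis element may be computed from any word of minimal length. -/
theorem heckeT_eq_prod {w : Perm (Fin n)} {a : List (Fin (n - 1))}
    (ha : (a.map (adjSwap n)).prod = w) (hl : a.length = inversionNumber w) :
    heckeT q w = (a.map (heckeGen q n)).prod := by
  have h := (exists_isReducedDecomposition w).choose_spec
  refine (satisfiesBraid_heckeGen q).prod_eq _ _ _ rfl ?_ ?_ ?_
  · rw [h.1, ha]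
  · rw [h.length_eq, h.1]
  · rw [ha, hl]

theorem heckeT_one : heckeT q (1 : Perm (Fin n)) = 1 :=
  (heckeT_eq_prod q (a := []) rfl inversionNumber_one.symm).trans rfl

theorem heckeGen_mul_heckeT_of_not_descent {w : Perm (Fin n)} {i : Fin (n - 1)}
    (h : ¬ IsLeftDescent w i) : heckeGen q n i * heckeT q w = heckeT q (adjSwap n i * w) := by
  obtain ⟨a, ha, hl⟩ := exists_word_length_eq_inversionNumber w
  rw [heckeT_eq_prod q ha hl, heckeT_eq_prod q (a := i :: a)]
  · simp
  · simp [ha]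
  · simp [hl, inversionNumber_adjSwap_mul w i h]

theorem heckeGen_mul_heckeT_of_descent {w : Perm (Fin n)} {i : Fin (n - 1)}
    (h : IsLeftDescent w i) : heckeGen q n i * heckeT q w =
      (q - 1) • heckeT q w + q • heckeT q (adjSwap n i * w) := by
  have h' : ¬ IsLeftDescent (adjSwap n i * w) i := by
    rw [isLeftDescent_adjSwap_mul]; exact not_not.2 h
  have e := heckeGen_mul_heckeT_of_not_descent q h'
  rw [adjSwap_mul_cancel] at e
  rw [← e, ← mul_assoc, heckeGen_mul_self, add_mul, smul_mul_assoc, smul_mul_assoc, one_mul]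

/-- The operator which multiplication by `T_i` induces on coefficient functions. -/
def heckeOp (i : Fin (n - 1)) : Module.End R (Perm (Fin n) → R) where
  toFun f u :=
    if IsLeftDescent u i then f (adjSwap n i * u) + (q - 1) * f u else q * f (adjSwap n i * u)
  map_add' f g := by
    ext u; simp only [Pi.add_apply]; split_ifs <;> ring
  map_smul' r f := by
    ext u; simp only [Pi.smul_apply, smul_eq_mul, RingHom.id_apply]; split_ifs <;> ring

theorem heckeOp_apply (i : Fin (n - 1)) (f : Perm (Fin n) → R) (u : Perm (Fin n)) :
    heckeOp q i f u =
      if IsLeftDescent u i then f (adjSwap n i * u) + (q - 1) * f u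
      else q * f (adjSwap n i * u) := rfl

theorem heckeOp_quadratic (i : Fin (n - 1)) :
    (heckeOp q i + 1) * (heckeOp q i - algebraMap R _ q) = 0 := by
  refine LinearMap.ext fun f => funext fun u => ?_
  simp only [Module.End.mul_apply, LinearMap.add_apply, LinearMap.sub_apply, Module.End.one_apply,
    Module.algebraMap_end_apply, LinearMap.zero_apply, Pi.add_apply, Pi.sub_apply, Pi.zero_apply,
    Pi.smul_apply, heckeOp_apply, isLeftDescent_adjSwap_mul, adjSwap_mul_cancel, smul_eq_mul]
  by_cases h : IsLeftDescent u i <;> simp only [h, if_true, if_false, not_true, not_false_iff] <;>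
    ring

theorem heckeOp_comm (i j : Fin (n - 1)) (h : (i : ℕ) + 2 ≤ j ∨ (j : ℕ) + 2 ≤ i) :
    heckeOp q i * heckeOp q j = heckeOp q j * heckeOp q i := by
  refine LinearMap.ext fun f => funext fun u => ?_
  have e : adjSwap n j * (adjSwap n i * u) = adjSwap n i * (adjSwap n j * u) := by
    rw [← mul_assoc, ← mul_assoc, adjSwap_comm i j h]
  simp only [Module.End.mul_apply, heckeOp_apply, isLeftDescent_adjSwap_mul_of_far h,
    isLeftDescent_adjSwap_mul_of_far h.symm, e]
  split_ifs <;> ring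

/-- Every descent condition that arises only compares the positions in u of three consecutive
letters. Of the eight sign patterns two are cyclic, hence impossible; the others are polynomial
identities. -/
theorem heckeOp_braid (i j : Fin (n - 1)) (h : (j : ℕ) = i + 1) :
    heckeOp q i * heckeOp q j * heckeOp q i = heckeOp q j * heckeOp q i * heckeOp q j := by
  refine LinearMap.ext fun f => funext fun u => ?_
  have hlo := adjLo_eq_adjHi h
  have h1 := adjSwap_adjHi_succ h
  have h2 := adjSwap_succ_adjLo h
  have h3 : adjSwap n j (adjHi i) = adjHi j := by rw [← hlo, adjSwap_adjLo]
  have n1 : u⁻¹ (adjLo i) ≠ u⁻¹ (adjHi i) := u⁻¹.injective.ne (adjLo_lt_adjHi i).ne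
  have n2 : u⁻¹ (adjHi i) ≠ u⁻¹ (adjHi j) := by
    rw [← hlo]; exact u⁻¹.injective.ne (adjLo_lt_adjHi j).ne
  have n3 : u⁻¹ (adjLo i) ≠ u⁻¹ (adjHi j) := by
    have := adjLo_lt_adjHi j
    rw [hlo] at this
    exact u⁻¹.injective.ne ((adjLo_lt_adjHi i).trans this).ne
  simp only [Module.End.mul_apply, heckeOp_apply, IsLeftDescent, inv_adjSwap_mul_apply, hlo,
    adjSwap_adjLo, adjSwap_adjHi, h1, h2, h3, adjSwap_mul_cancel, ← adjSwap_braid_mul h]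
  rcases lt_or_gt_of_ne n1 with a | a <;> rcases lt_or_gt_of_ne n2 with b | b <;>
    rcases lt_or_gt_of_ne n3 with c | c <;>
    first
    | exact absurd (a.trans b) c.asymm
    | exact absurd (b.trans a) c.asymm
    | (simp only [a, b, c, a.asymm, b.asymm, c.asymm, if_true, if_false]; done)
    | (simp only [a, b, c, a.asymm, b.asymm, c.asymm, if_true, if_false]; ring)

/-- The regular representation of the Hecke algebra on coefficient functions. -/
noncomputable def heckeRep : HeckeAlgebra R q n →ₐ[R] Module.End R (Perm (Fin n) → R) :=
  RingQuot.liftAlgHom R ⟨FreeAlgebra.lift R (heckeOp q), by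
    intro x y hxy
    cases hxy with
    | quadratic i => simpa using heckeOp_quadratic q i
    | comm i j h => simpa using heckeOp_comm q i j h
    | braid i j h => simpa using heckeOp_braid q i j h⟩

theorem heckeRep_heckeGen (i : Fin (n - 1)) : heckeRep q (heckeGen q n i) = heckeOp q i := by
  rw [heckeRep, heckeGen, RingQuot.liftAlgHom_mkAlgHom_apply, FreeAlgebra.lift_ι_apply]

theorem heckeOp_single_of_not_descent {w : Perm (Fin n)} {i : Fin (n - 1)}
    (h : ¬ IsLeftDescent w i) :
    heckeOp q i (Pi.single w 1) = Pi.single (adjSwap n i * w) 1 := by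
  funext u
  rw [heckeOp_apply]
  by_cases hu : u = adjSwap n i * w
  · subst hu
    have hne : adjSwap n i * w ≠ w := fun e => by
      have := isLeftDescent_adjSwap_mul w i
      rw [e] at this
      tauto
    rw [if_pos ((isLeftDescent_adjSwap_mul w i).2 h), adjSwap_mul_cancel, Pi.single_eq_same,
      Pi.single_eq_same, Pi.single_eq_of_ne hne]
    ring
  · have hu' : adjSwap n i * u ≠ w := fun e => hu (by rw [← e, adjSwap_mul_cancel])
    rw [Pi.single_eq_of_ne hu, Pi.single_eq_of_ne hu']
    split_ifs with hd
    · rw [Pi.single_eq_of_ne]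
      · ring
      · rintro rfl; exact h hd
    · ring

theorem heckeRep_heckeT_apply (w : Perm (Fin n)) :
    heckeRep q (heckeT q w) (Pi.single 1 1) = Pi.single w 1 := by
  induction hk : inversionNumber w generalizing w with
  | zero =>
    have : w = 1 := eq_one_of_no_leftDescent w fun i hi => by
      have := inversionNumber_adjSwap_mul_add_one w i hi
      omega
    rw [this, heckeT_one, map_one, Module.End.one_apply]
  | succ k ih =>
    have : ∃ i, IsLeftDescent w i := by
      by_contra! hne
      rw [eq_one_of_no_leftDescent w hne, inversionNumber_one] at hk
      omega
    obtain ⟨i, hi⟩ := this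
    have h1 := inversionNumber_adjSwap_mul_add_one w i hi
    have h' : ¬ IsLeftDescent (adjSwap n i * w) i := by
      rw [isLeftDescent_adjSwap_mul]; exact not_not.2 hi
    have e := heckeGen_mul_heckeT_of_not_descent q h'
    rw [adjSwap_mul_cancel] at e
    rw [← e, map_mul, Module.End.mul_apply, ih _ (by omega), heckeRep_heckeGen,
      heckeOp_single_of_not_descent q h', adjSwap_mul_cancel]

/-- Acting on the indicator of 1 recovers the coefficient function. -/
theorem sum_smul_heckeT_injective :
    Function.Injective fun c : Perm (Fin n) → R => ∑ w, c w • heckeT q w := by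
  have key : ∀ c : Perm (Fin n) → R,
      heckeRep q (∑ w, c w • heckeT q w) (Pi.single 1 1) = c := by
    intro c
    rw [map_sum, LinearMap.sum_apply]
    simp only [map_smul, LinearMap.smul_apply, heckeRep_heckeT_apply]
    funext u
    simp [Finset.sum_apply, Pi.single_apply]
  intro c d h
  rw [← key c, ← key d]
  exact congrArg (fun x => heckeRep q x (Pi.single 1 1)) h

/-- The terms landing on T_{s_i w} are reindexed by the involution w ↦ s_i w, which exchanges
descents and non-descents. -/
theorem heckeGen_mul_sum (i : Fin (n - 1)) (c : Perm (Fin n) → R) :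
    heckeGen q n i * ∑ w, c w • heckeT q w = ∑ w, heckeOp q i c w • heckeT q w := by
  have hL : heckeGen q n i * ∑ w, c w • heckeT q w =
      ∑ w, ((if IsLeftDescent w i then (q - 1) * c w else 0) • heckeT q w +
        (if IsLeftDescent w i then q * c w else c w) • heckeT q (adjSwap n i * w)) := by
    rw [Finset.mul_sum]
    refine Finset.sum_congr rfl fun w _ => ?_
    rw [mul_smul_comm]
    split_ifs with h
    · rw [heckeGen_mul_heckeT_of_descent q h, smul_add, smul_smul, smul_smul, mul_comm (c w),
        mul_comm (c w)]
    · rw [heckeGen_mul_heckeT_of_not_descent q h, zero_smul, zero_add]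
  rw [hL, Finset.sum_add_distrib,
    ← Equiv.sum_comp (Equiv.mulLeft (adjSwap n i)) fun w =>
      (if IsLeftDescent w i then q * c w else c w) • heckeT q (adjSwap n i * w),
    ← Finset.sum_add_distrib]
  refine Finset.sum_congr rfl fun w _ => ?_
  rw [Equiv.coe_mulLeft, adjSwap_mul_cancel, ← add_smul, heckeOp_apply]
  by_cases h : IsLeftDescent w i <;>
    simp only [isLeftDescent_adjSwap_mul, h, if_true, if_false, not_true, not_false_iff]
  · rw [add_comm]
  · rw [zero_add]

end HeckeAlgebra

/-! ### Counting cycles as orbits. -/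

section NumCycles

variable {n : ℕ}

theorem card_fixed_add_sum_cycleType (x : Perm (Fin n)) :
    (Finset.univ.filter fun i => x i = i).card + x.cycleType.sum = n := by
  rw [Perm.sum_cycleType, Perm.support]
  conv_rhs => rw [← Fintype.card_fin n, ← Finset.card_univ]
  exact Finset.card_filter_add_card_filter_not _

/-- The cycle type omits fixed points, but their number is n minus its sum. -/
theorem numCycles_eq_of_cycleType_eq {x y : Perm (Fin n)} (h : x.cycleType = y.cycleType) :
    numCycles x = numCycles y := by
  have hx := card_fixed_add_sum_cycleType x
  have hy := card_fixed_add_sum_cycleType y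
  unfold numCycles
  rw [h] at hx ⊢
  omega

/-- Counting orbits lets cycle numbers be compared through surjections of quotients. -/
theorem numCycles_eq_card_quotient (x : Perm (Fin n)) :
    numCycles x = Nat.card (Quotient (Perm.SameCycle.setoid x)) := by
  classical
  let F : Fin n → x.cycleFactorsFinset ⊕ (Finset.univ.filter fun i => x i = i : Finset (Fin n)) :=
    fun z => if h : x z = z then Sum.inr ⟨z, by simpa using h⟩
      else Sum.inl ⟨x.cycleOf z, Perm.cycleOf_mem_cycleFactorsFinset_iff.2 (by simpa using h)⟩
  have hF : ∀ y z, F y = F z ↔ x.SameCycle y z := by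
    intro y z
    by_cases hy : x y = y <;> by_cases hz : x z = z <;> simp only [F, hy, hz, dite_true, dite_false]
    · simp only [Sum.inr.injEq, Subtype.mk.injEq]
      refine ⟨fun h => h ▸ Perm.SameCycle.refl _ _, fun h => (Perm.SameCycle.eq_of_left h hy)⟩
    · refine iff_of_false (by simp) fun h => hz ?_
      exact (h.apply_eq_self_iff).1 hy
    · refine iff_of_false (by simp) fun h => hy ?_
      exact (h.apply_eq_self_iff).2 hz
    · simp only [Sum.inl.injEq, Subtype.mk.injEq]
      exact (Perm.sameCycle_iff_cycleOf_eq_of_mem_support (by simpa using hy)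
        (by simpa using hz)).symm
  have hsurj : Function.Surjective F := by
    rintro (⟨c, hc⟩ | ⟨z, hz⟩)
    · obtain ⟨z, hz⟩ := (Perm.mem_cycleFactorsFinset_iff.1 hc).1.nonempty_support
      refine ⟨z, ?_⟩
      have hx : x z ≠ z := by
        rw [← (Perm.mem_cycleFactorsFinset_iff.1 hc).2 z hz]
        exact Perm.mem_support.1 hz
      simp only [F, hx, dite_false, Sum.inl.injEq, Subtype.mk.injEq]
      exact (Perm.cycle_is_cycleOf hz hc).symm
    · exact ⟨z, by simp [F, (Finset.mem_filter.1 hz).2]⟩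
  have e : Quotient (Perm.SameCycle.setoid x) ≃
      x.cycleFactorsFinset ⊕ (Finset.univ.filter fun i => x i = i : Finset (Fin n)) :=
    Equiv.ofBijective (Quotient.lift F fun y z h => (hF y z).2 h)
      ⟨by
        rintro ⟨y⟩ ⟨z⟩ h
        exact Quotient.sound ((hF y z).1 h),
      fun s => by
        obtain ⟨z, hz⟩ := hsurj s
        exact ⟨Quotient.mk _ z, hz⟩⟩
  rw [Nat.card_congr e, Nat.card_sum]
  simp [numCycles, Perm.cycleType_def, Fintype.card_subtype]

/-- Multiplication by a transposition lowers the number of cycles by at most one. -/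
theorem numCycles_le_numCycles_swap_mul_add_one (a b : Fin n) (x : Perm (Fin n)) :
    numCycles x ≤ numCycles (swap a b * x) + 1 := by
  classical
  rw [numCycles_eq_card_quotient, numCycles_eq_card_quotient]
  let mk : Fin n → Quotient (Perm.SameCycle.setoid x) := Quotient.mk _
  have mk_apply : ∀ z, mk (x z) = mk z := fun z =>
    Quotient.sound (Perm.SameCycle.symm (Perm.sameCycle_apply_right.2 (Perm.SameCycle.refl _ _)))
  -- Merging the class of a into that of b gives a map invariant under both x and the transposition,
  -- hence constant on orbits of their product.
  let h : Fin n → Quotient (Perm.SameCycle.setoid x) := fun z => if mk z = mk a then mk b else mk z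
  have hb : h b = mk b := by simp only [h]; split_ifs <;> rfl
  have ha : h a = mk b := by simp [h]
  have hswap : ∀ z, h (swap a b z) = h z := by
    intro z
    rw [swap_apply_def]
    split_ifs with h1 h2
    · rw [h1, ha, hb]
    · rw [h2, ha, hb]
    · rfl
  have hinv : ∀ z, h ((swap a b * x) z) = h z := fun z => by
    rw [Perm.mul_apply, hswap]
    simp only [h, mk_apply]
  have hpow : ∀ (k : ℕ) z, h (((swap a b * x) ^ k) z) = h z := by
    intro k z
    induction k with
    | zero => rfl
    | succ k ih => rw [pow_succ', Perm.mul_apply, hinv, ih]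
  -- The merging loses at most the class of a; the extra point `none` restores it and accounts for
  -- the +1.
  let g : Option (Quotient (Perm.SameCycle.setoid (swap a b * x))) →
      Quotient (Perm.SameCycle.setoid x) := fun o =>
    o.elim (mk a) (Quotient.lift h fun y z hyz => by
      obtain ⟨k, -, -, rfl⟩ := Perm.SameCycle.exists_pow_eq _ hyz
      exact (hpow k y).symm)
  have hg : Function.Surjective g := by
    rintro ⟨z⟩
    by_cases hz : mk z = mk a
    · exact ⟨none, hz.symm⟩
    · refine ⟨some (Quotient.mk _ z), ?_⟩
      change h z = mk z
      simp [h, hz]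
  have := Nat.card_le_card_of_surjective g hg
  rwa [Finite.card_option] at this

end NumCycles

/-! ### The underlying permutation of the word is w₀. -/

section EvacWord

variable {n : ℕ}

theorem prod_take_finRange_val (k : ℕ) (hk : k ≤ n - 1) (x : Fin n) :
    ((((List.finRange (n - 1)).take k).map (adjSwap n)).prod x : ℕ) =
      if (x : ℕ) < k then (x : ℕ) + 1 else if (x : ℕ) = k then 0 else x := by
  induction k generalizing x with
  | zero => simp
  | succ k ih =>
    rw [List.take_succ_eq_append_getElem (by simpa using hk), List.map_append, List.prod_append,
      Perm.mul_apply, ih (by omega)]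
    simp only [List.getElem_finRange, List.map_cons, List.map_nil, List.prod_singleton,
      adjSwap_val, Fin.val_cast]
    split_ifs <;> omega

/-- The last k blocks have lengths k, …, 1. Prepending a block of length k+1 applies, after the
reversal of 0, …, k, the cycle sending each x ≤ k to x+1 and k+1 to 0, which reverses 0, …, k+1. -/
theorem prod_flatMap_drop_val (k : ℕ) (hk : k ≤ n - 1) (x : Fin n) :
    (((((List.finRange (n - 1)).drop (n - 1 - k)).flatMap fun j : Fin (n - 1) =>
      (List.finRange (n - 1)).take (n - 1 - j)).map (adjSwap n)).prod x : ℕ) =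
      if (x : ℕ) ≤ k then k - (x : ℕ) else x := by
  induction k generalizing x with
  | zero =>
    rw [List.drop_of_length_le (by simp)]
    simp
  | succ k ih =>
    rw [List.drop_eq_getElem_cons (by simp; omega), List.flatMap_cons, List.map_append,
      List.prod_append, Perm.mul_apply, List.getElem_finRange,
      show n - 1 - (k + 1) + 1 = n - 1 - k by omega]
    simp only [Fin.val_cast]
    rw [show n - 1 - (n - 1 - (k + 1)) = k + 1 by omega, prod_take_finRange_val _ hk,
      ih (by omega)]
    split_ifs <;> omega

/-- Removes the monadic coercion of the index list inside `evacWord`, so that the index ranges over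
`Fin (n - 1)`. -/
theorem evacWord_eq_flatMap (n : ℕ) :
    evacWord n = (List.finRange (n - 1)).flatMap fun j : Fin (n - 1) =>
      (List.finRange (n - 1)).take (n - 1 - j) := by
  simp only [evacWord, List.bind_eq_flatMap, List.pure_def, List.flatMap_assoc,
    List.flatMap_singleton]

theorem prod_evacWord (n : ℕ) : ((evacWord n).map (adjSwap n)).prod = Fin.revPerm := by
  ext x
  have h := prod_flatMap_drop_val (n - 1) le_rfl x
  rw [Nat.sub_self, List.drop_zero] at h
  rw [evacWord_eq_flatMap, h, Fin.revPerm_apply, Fin.val_rev]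
  split_ifs <;> omega

/-- Inversion and conjugation by w turn w⁻¹w₀ into ww₀, and both preserve cycle type. -/
theorem numCycles_inv_mul_revPerm (w : Perm (Fin n)) :
    numCycles (w⁻¹ * Fin.revPerm) = numCycles (reversal w) := by
  apply numCycles_eq_of_cycleType_eq
  have h : reversal w = w * (w⁻¹ * Fin.revPerm)⁻¹ * w⁻¹ := by
    have : (Fin.revPerm : Perm (Fin n))⁻¹ = Fin.revPerm := by
      ext x; rfl
    rw [mul_inv_rev, this, inv_inv, mul_assoc, mul_assoc, mul_inv_cancel, mul_one]
    rfl
  rw [h, Perm.cycleType_conj, Perm.cycleType_inv]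

end EvacWord

/-! ### Divisibility by powers of q-1. -/

section Divisibility

variable (K : Type*) [Field K]

/-- The subalgebra `K[q, (q + 1)⁻¹]` of `K(q)`. -/
noncomputable def polyInvSubalgebra : Subalgebra K (RatFunc K) :=
  Algebra.adjoin K {RatFunc.X, (RatFunc.X + 1)⁻¹}

variable {K}

theorem ratFunc_X_add_one_ne_zero : (RatFunc.X + 1 : RatFunc K) ≠ 0 := by
  have : algebraMap (Polynomial K) (RatFunc K) (Polynomial.X + 1) ≠ 0 := by
    rw [Ne, FaithfulSMul.algebraMap_eq_zero_iff]
    simpa using Polynomial.X_add_C_ne_zero (1 : K)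
  simpa using this

theorem exists_of_mem_polyInvSubalgebra {x : RatFunc K} (hx : x ∈ polyInvSubalgebra K) :
    ∃ (g : Polynomial K) (N : ℕ),
      x = algebraMap (Polynomial K) (RatFunc K) g / (RatFunc.X + 1) ^ N := by
  have hne := ratFunc_X_add_one_ne_zero (K := K)
  have hX : algebraMap (Polynomial K) (RatFunc K) (Polynomial.X + 1) = RatFunc.X + 1 := by simp
  induction hx using Algebra.adjoin_induction with
  | mem x hx =>
    rcases hx with rfl | rfl
    · exact ⟨Polynomial.X, 0, by simp⟩
    · exact ⟨1, 1, by simp⟩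
  | algebraMap r =>
    refine ⟨Polynomial.C r, 0, ?_⟩
    rw [pow_zero, div_one, IsScalarTower.algebraMap_apply K (Polynomial K) (RatFunc K)]
    rfl
  | add x y _ _ hx hy =>
    obtain ⟨g, N, rfl⟩ := hx
    obtain ⟨h, M, rfl⟩ := hy
    refine ⟨g * (Polynomial.X + 1) ^ M + (Polynomial.X + 1) ^ N * h, N + M, ?_⟩
    rw [map_add, map_mul, map_mul, map_pow, map_pow, hX, pow_add,
      div_add_div _ _ (pow_ne_zero _ hne) (pow_ne_zero _ hne)]
  | mul x y _ _ hx hy =>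
    obtain ⟨g, N, rfl⟩ := hx
    obtain ⟨h, M, rfl⟩ := hy
    exact ⟨g * h, N + M, by rw [map_mul, pow_add, div_mul_div_comm]⟩

/-- `x` is divisible by `(q - 1) ^ d` in `K[q, (q + 1)⁻¹]`. -/
def IsDivisibleBy (d : ℕ) (x : RatFunc K) : Prop :=
  ∃ b ∈ polyInvSubalgebra K, x = (RatFunc.X - 1) ^ d * b

theorem X_mem_polyInvSubalgebra : (RatFunc.X : RatFunc K) ∈ polyInvSubalgebra K :=
  Algebra.subset_adjoin (by simp)

theorem inv_mem_polyInvSubalgebra : (RatFunc.X + 1 : RatFunc K)⁻¹ ∈ polyInvSubalgebra K :=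
  Algebra.subset_adjoin (by simp)

theorem X_sub_one_mem_polyInvSubalgebra : (RatFunc.X - 1 : RatFunc K) ∈ polyInvSubalgebra K :=
  sub_mem X_mem_polyInvSubalgebra (one_mem _)

namespace IsDivisibleBy

variable {d e : ℕ} {x y : RatFunc K}

theorem add (hx : IsDivisibleBy d x) (hy : IsDivisibleBy d y) : IsDivisibleBy d (x + y) := by
  obtain ⟨b, hb, rfl⟩ := hx
  obtain ⟨c, hc, rfl⟩ := hy
  exact ⟨b + c, add_mem hb hc, (mul_add _ _ _).symm⟩

theorem mul_left (hx : IsDivisibleBy d x) (hy : y ∈ polyInvSubalgebra K) :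
    IsDivisibleBy d (y * x) := by
  obtain ⟨b, hb, rfl⟩ := hx
  exact ⟨y * b, mul_mem hy hb, by ring⟩

theorem X_sub_one_mul (hx : IsDivisibleBy d x) (h : e ≤ d + 1) :
    IsDivisibleBy e ((RatFunc.X - 1) * x) := by
  obtain ⟨b, hb, rfl⟩ := hx
  obtain ⟨k, hk⟩ := Nat.exists_eq_add_of_le h
  refine ⟨(RatFunc.X - 1) ^ k * b, mul_mem (pow_mem X_sub_one_mem_polyInvSubalgebra k) hb, ?_⟩
  rw [← mul_assoc, ← mul_assoc, ← pow_add, ← hk, pow_succ']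

end IsDivisibleBy

variable {n : ℕ}

/-- Moving s_i to the left past u⁻¹ conjugates it into another transposition, so the orbit count
applies. -/
theorem sub_numCycles_le (u v : Perm (Fin n)) (i : Fin (n - 1)) :
    n - numCycles (u⁻¹ * (adjSwap n i * v)) ≤ n - numCycles (u⁻¹ * v) + 1 := by
  have h : u⁻¹ * (adjSwap n i * v) = swap (u⁻¹ (adjLo i)) (u⁻¹ (adjHi i)) * (u⁻¹ * v) := by
    rw [← mul_assoc, ← mul_assoc, adjSwap_eq, mul_swap_eq_swap_mul]
  have := numCycles_le_numCycles_swap_mul_add_one (u⁻¹ (adjLo i)) (u⁻¹ (adjHi i)) (u⁻¹ * v)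
  rw [h]
  omega

/-- Allowing an arbitrary word, with w compared to the word's own product, is what makes induction
on the word possible. -/
theorem exists_expansion_prod_heckeE (a : List (Fin (n - 1))) :
    ∃ c : Perm (Fin n) → RatFunc K,
      (a.map (heckeE (RatFunc.X : RatFunc K) n)).prod =
        ∑ w, c w • heckeT (RatFunc.X : RatFunc K) w ∧
      ∀ w, IsDivisibleBy (n - numCycles (w⁻¹ * (a.map (adjSwap n)).prod)) (c w) := by
  induction a with
  | nil =>
    refine ⟨Pi.single 1 1, ?_, fun w => ?_⟩
    · rw [Finset.sum_eq_single 1 (fun w _ hw => by rw [Pi.single_eq_of_ne hw, zero_smul])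
        (fun h => absurd (Finset.mem_univ _) h), Pi.single_eq_same, one_smul, heckeT_one]
      rfl
    · by_cases hw : w = 1
      · subst hw
        refine ⟨1, one_mem _, ?_⟩
        have : n - numCycles ((1 : Perm (Fin n))⁻¹ * (([] : List (Fin (n - 1))).map
          (adjSwap n)).prod) = 0 := by simp [numCycles]
        rw [this, Pi.single_eq_same, pow_zero, one_mul]
      · exact ⟨0, zero_mem _, by rw [Pi.single_eq_of_ne hw, mul_zero]⟩
  | cons i a ih =>
    obtain ⟨c, hc, hd⟩ := ih
    refine ⟨fun w => (RatFunc.X + 1)⁻¹ * ((RatFunc.X - 1) * c w +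
      (-2) * heckeOp (RatFunc.X : RatFunc K) i c w), ?_, fun w => ?_⟩
    · rw [List.map_cons, List.prod_cons, hc, heckeE, smul_mul_assoc, sub_mul,
        mul_assoc, heckeGen_mul_sum, Algebra.algebraMap_eq_smul_one, smul_mul_assoc, one_mul]
      simp only [mul_smul, add_smul, Finset.sum_add_distrib, ← Finset.smul_sum]
      rw [sub_eq_add_neg, neg_smul, two_mul, two_smul]
    · rw [List.map_cons, List.prod_cons]
      have hle := sub_numCycles_le w (a.map (adjSwap n)).prod i
      have h1 := (hd w).X_sub_one_mul hle
      -- No factor q-1 is needed here: the exponent at s_i w for the old product equals that at w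
      -- for the new one.
      have h2 := hd (adjSwap n i * w)
      rw [mul_inv_rev, adjSwap_inv, mul_assoc] at h2
      refine IsDivisibleBy.mul_left (h1.add (IsDivisibleBy.mul_left ?_ ?_))
        inv_mem_polyInvSubalgebra
      · rw [heckeOp_apply]
        split_ifs
        · exact h2.add h1
        · exact h2.mul_left X_mem_polyInvSubalgebra
      · exact neg_mem (ofNat_mem _ 2)

end Divisibility

theorem theorem5p2 (K : Type*) [Field K] [CharZero K] (n : ℕ) :
    (∃! c : Equiv.Perm (Fin n) → RatFunc K, IsEvacExpansion (RatFunc.X : RatFunc K) n c) ∧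
    ∀ c : Equiv.Perm (Fin n) → RatFunc K, IsEvacExpansion (RatFunc.X : RatFunc K) n c →
      ∀ w : Equiv.Perm (Fin n), ∃ (g : Polynomial K) (N : ℕ),
        c w = (RatFunc.X - 1) ^ (n - numCycles (reversal w)) *
          (algebraMap (Polynomial K) (RatFunc K) g / (RatFunc.X + 1) ^ N) := by
  obtain ⟨c, hc, hd⟩ := exists_expansion_prod_heckeE (K := K) (evacWord n)
  have huniq : ∀ c' : Perm (Fin n) → RatFunc K,
      IsEvacExpansion (RatFunc.X : RatFunc K) n c' → c' = c := fun c' hc' =>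
    sum_smul_heckeT_injective (RatFunc.X : RatFunc K) (hc'.symm.trans hc)
  refine ⟨⟨c, hc, huniq⟩, fun c' hc' w => ?_⟩
  rw [huniq c' hc']
  obtain ⟨b, hb, hcb⟩ := hd w
  obtain ⟨g, N, rfl⟩ := exists_of_mem_polyInvSubalgebra hb
  rw [prod_evacWord, numCycles_inv_mul_revPerm] at hcb
  exact ⟨g, N, hcb⟩
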